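/- **Proposition.** Let $p\ge 0$ be an integer, let $q\in\{1,2\}$, and let $\mu$ be a finite Borel measure on $[0,\infty)$ with $\mu((0,\infty))>0$ whose support is bounded and bounded away from zero, i.e. $0<m_\mu\le M_\mu<\infty$ with $m_\mu=\inf\operatorname{supp}(\mu)$ and $M_\mu=\sup\operatorname{supp}(\mu)$. Put $h(z)=\int_0^\infty e^{-tz}\,\mu(dt)$ for $z\ge 0$, and let $\mathcal H$ be the real reproducing kernel Hilbert space of functions on $\mathbb R^p$ with kernel $k(x,x')=h(\|x-x'\|_q^q)$. Let $Q$ be a probability distribution of a pair $(X,Y)\in\mathbb R^p\times\mathbb R$ with $\mathbb E_Q[Y^2]<\infty$. For $\beta\in\mathbb R^p$ with $\beta\ge 0$ (coordinatewise) and $\lambda>0$ define $$F^{\mathrm{KRR}}_\lambda(\beta;Q)=\min_{f\in\mathcal H}\ \tfrac12\,\mathbb E_Q\big[(Y-f(\beta^{1/q}\odot X))^2\big]+\tfrac{\lambda}{2}\|f\|_{\mathcal H}^2,$$ where $\beta^{1/q}\odot X=(\beta_i^{1/q}X_i)_{i\le p}$. Then for every $\beta\ge 0$ this minimum is attained for every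 $\lambda>0$, and $$\lim_{\lambda\to0^+}F^{\mathrm{KRR}}_\lambda(\beta;Q)=\tfrac12\,\mathbb E_Q\big[\operatorname{Var}(Y\mid X_{\operatorname{supp}(\beta)})\big],$$ where $\operatorname{supp}(\beta)=\{i:\beta_i\ne 0\}$ and $X_S=(X_i)_{i\in S}$. -/

import Mathlib

open MeasureTheory ProbabilityTheory Filter Topology
open scoped NNReal

noncomputable section

namespace KernelFeature

/-- The profile `h(z) = ∫ exp(-t z) μ(dt)` attached to a measure `μ` on `ℝ₊`. -/
def profile (μ : Measure ℝ≥0) (z : ℝ) : ℝ := ∫ t, Real.exp (-(t : ℝ) * z) ∂μ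

/-- The measure `μ` charges `(0, ∞)` and its support is bounded and bounded away from zero. Since `sInf ∅ = 0` in `ℝ≥0`, the
condition on the infimum also says that the support is nonempty. -/
structure SupportRegular (μ : Measure ℝ≥0) : Prop where
  pos_mass : 0 < μ (Set.Ioi 0)
  inf_pos : 0 < sInf μ.support
  bddAbove : BddAbove μ.support

/-- The `ℓ_q`-type kernel `k(x, x') = h(‖x - x'‖_q ^ q)` on `ℝ^p`; the scalar `k(x, x')` is
regarded as an operator on `ℝ`, as in `RKHS.kernel`. -/
def lqKernel (μ : Measure ℝ≥0) (q p : ℕ) : Matrix (Fin p → ℝ) (Fin p → ℝ) (ℝ →L[ℝ] ℝ) :=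
  .of fun x x' => profile μ (∑ i, |x i - x' i| ^ q) • ContinuousLinearMap.id ℝ ℝ

theorem posSemidef_integral {n Ω : Type*} [MeasurableSpace Ω] (ν : Measure Ω)
    (K : Ω → Matrix n n ℝ) (hK : ∀ u, (K u).PosSemidef)
    (hint : ∀ i j, Integrable (fun u => K u i j) ν) :
    (Matrix.of fun i j => ∫ u, K u i j ∂ν).PosSemidef := by
  refine ⟨?_, fun x => ?_⟩
  · ext i j
    simp only [Matrix.conjTranspose_apply, Matrix.of_apply, star_trivial]
    congr 1
    ext u
    exact (hK u).1.apply i j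
  · have h : (x.sum fun i xi => x.sum fun j xj => star xi *
        (Matrix.of fun i j => ∫ u, K u i j ∂ν) i j * xj) =
        ∫ u, (x.sum fun i xi => x.sum fun j xj => star xi * K u i j * xj) ∂ν := by
      simp only [Finsupp.sum, Matrix.of_apply]
      rw [integral_finsetSum _ fun i _ => integrable_finsetSum _ fun j _ =>
        ((hint i j).const_mul _).mul_const _]
      refine Finset.sum_congr rfl fun i _ => ?_
      rw [integral_finsetSum _ fun j _ => ((hint i j).const_mul _).mul_const _]
      refine Finset.sum_congr rfl fun j _ => ?_
      rw [integral_mul_const, integral_const_mul]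
    rw [h]
    exact integral_nonneg fun u => (hK u).2 x

theorem posSemidef_rankOne {n : Type*} (f : n → ℝ) :
    (Matrix.of fun i j => f i * f j).PosSemidef := by
  refine ⟨?_, fun x => ?_⟩
  · ext i j
    simp [mul_comm]
  · have h : (x.sum fun i xi => x.sum fun j xj => star xi *
        (Matrix.of fun i j => f i * f j) i j * xj) = (x.sum fun i xi => xi * f i) ^ 2 := by
      simp only [Finsupp.sum, Matrix.of_apply, star_trivial, sq, Finset.sum_mul_sum]
      exact Finset.sum_congr rfl fun i _ => Finset.sum_congr rfl fun j _ => by ring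
    rw [h]
    positivity

theorem posSemidef_exp_abs (s : ℝ) (hs : 0 ≤ s) :
    (Matrix.of fun a b : ℝ => Real.exp (-s * |a - b|)).PosSemidef := by
  have hi : ∀ a b : ℝ, Integrable (fun u =>
      (Real.exp (-s * a) * (Set.Ioc 0 (Real.exp (2 * s * a))).indicator 1 u) *
      (Real.exp (-s * b) * (Set.Ioc 0 (Real.exp (2 * s * b))).indicator (1 : ℝ → ℝ) u)) := by
    intro a b
    have h : Integrable ((Set.Ioc 0 (Real.exp (2 * s * a)) ∩
        Set.Ioc 0 (Real.exp (2 * s * b))).indicator (1 : ℝ → ℝ)) := by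
      rw [integrable_indicator_iff (measurableSet_Ioc.inter measurableSet_Ioc)]
      exact integrableOn_const (by
        rw [Set.Ioc_inter_Ioc]; simp)
    refine (h.const_mul (Real.exp (-s * a) * Real.exp (-s * b))).congr (.of_forall fun u => ?_)
    simp only [Set.inter_indicator_one, Pi.mul_apply]
    ring
  convert! posSemidef_integral (volume : Measure ℝ) (fun u => .of fun a b : ℝ =>
      (Real.exp (-s * a) * (Set.Ioc 0 (Real.exp (2 * s * a))).indicator 1 u) *
      (Real.exp (-s * b) * (Set.Ioc 0 (Real.exp (2 * s * b))).indicator (1 : ℝ → ℝ) u))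
      (fun u => posSemidef_rankOne _) hi using 1
  ext a b
  have h : ∀ u, (Real.exp (-s * a) * (Set.Ioc 0 (Real.exp (2 * s * a))).indicator 1 u) *
      (Real.exp (-s * b) * (Set.Ioc 0 (Real.exp (2 * s * b))).indicator (1 : ℝ → ℝ) u) =
      (Real.exp (-s * a) * Real.exp (-s * b)) * (Set.Ioc 0 (Real.exp (2 * s * a)) ∩
        Set.Ioc 0 (Real.exp (2 * s * b))).indicator (1 : ℝ → ℝ) u := fun u => by
    simp only [Set.inter_indicator_one, Pi.mul_apply]
    ring
  simp only [Matrix.of_apply, h]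
  rw [integral_const_mul, integral_indicator_one (measurableSet_Ioc.inter measurableSet_Ioc),
    Set.Ioc_inter_Ioc, Real.volume_real_Ioc]
  rcases le_total a b with hab | hab
  · have : Real.exp (2 * s * a) ≤ Real.exp (2 * s * b) := Real.exp_le_exp.2 (by nlinarith)
    rw [abs_of_nonpos (by linarith), inf_eq_left.2 this, sup_idem, sub_zero,
      max_eq_left (Real.exp_pos _).le, ← Real.exp_add, ← Real.exp_add]
    ring_nf
  · have : Real.exp (2 * s * b) ≤ Real.exp (2 * s * a) := Real.exp_le_exp.2 (by nlinarith)
    rw [abs_of_nonneg (by linarith), inf_eq_right.2 this, sup_idem, sub_zero,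
      max_eq_left (Real.exp_pos _).le, ← Real.exp_add, ← Real.exp_add]
    ring_nf

theorem posSemidef_exp_sq (s : ℝ) (hs : 0 ≤ s) :
    (Matrix.of fun a b : ℝ => Real.exp (-s * |a - b| ^ 2)).PosSemidef := by
  obtain ⟨v, hv⟩ : ∃ v : ℝ≥0, (v : ℝ) = 2 * s := ⟨⟨2 * s, by positivity⟩, rfl⟩
  have hE : ∀ a b u : ℝ, Real.exp (-2 * s * a ^ 2 + a * u) * Real.exp (-2 * s * b ^ 2 + b * u) =
      Real.exp (-2 * s * a ^ 2 - 2 * s * b ^ 2) * Real.exp ((a + b) * u) := fun a b u => by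
    rw [← Real.exp_add, ← Real.exp_add]
    ring_nf
  have hi : ∀ a b : ℝ, Integrable (fun u =>
      Real.exp (-2 * s * a ^ 2 + a * u) * Real.exp (-2 * s * b ^ 2 + b * u))
      (gaussianReal 0 v) := by
    intro a b
    simp only [hE]
    exact (integrable_exp_mul_gaussianReal _).const_mul _
  convert! posSemidef_integral (gaussianReal 0 v)
      (fun u => .of fun a b : ℝ =>
        Real.exp (-2 * s * a ^ 2 + a * u) * Real.exp (-2 * s * b ^ 2 + b * u))
      (fun u => posSemidef_rankOne _) hi using 1
  ext a b
  have hm := mgf_gaussianReal (p := gaussianReal 0 v) (X := id)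
    Measure.map_id (a + b)
  simp only [mgf, id] at hm
  simp only [Matrix.of_apply, hE]
  rw [integral_const_mul, hm, ← Real.exp_add, sq_abs]
  congr 1
  rw [hv]
  ring

theorem posSemidef_exp_sum (s : ℝ) (hs : 0 ≤ s) (q p : ℕ) (hq : q = 1 ∨ q = 2) :
    (Matrix.of fun x y : Fin p → ℝ => Real.exp (-s * ∑ i, |x i - y i| ^ q)).PosSemidef := by
  have h1 : (Matrix.of fun a b : ℝ => Real.exp (-s * |a - b| ^ q)).PosSemidef := by
    rcases hq with rfl | rfl
    · simpa using posSemidef_exp_abs s hs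
    · exact posSemidef_exp_sq s hs
  have h2 : ∀ T : Finset (Fin p), (Matrix.of fun x y : Fin p → ℝ =>
      Real.exp (-s * ∑ i ∈ T, |x i - y i| ^ q)).PosSemidef := by
    classical
    intro T
    induction T using Finset.induction_on with
    | empty => simpa using posSemidef_rankOne (fun _ : Fin p → ℝ => (1 : ℝ))
    | insert i T hi ih =>
      convert! (h1.submatrix fun x : Fin p → ℝ => x i).hadamard ih using 1
      ext x y
      simp only [Matrix.of_apply, Matrix.hadamard_apply, Matrix.submatrix_apply,
        Finset.sum_insert hi, mul_add, Real.exp_add]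
  exact h2 Finset.univ

/-- The `ℓ_q`-type kernel is positive semidefinite, so that an RKHS with this kernel exists, namely
`RKHS.OfKernel (lqKernel μ q p)`; see `RKHS.OfKernel.kernel_ofKernel`. -/
theorem posSemidef_lqKernel (μ : Measure ℝ≥0) [IsFiniteMeasure μ] (q p : ℕ)
    (hq : q = 1 ∨ q = 2) : (lqKernel μ q p).PosSemidef := by
  have hi : ∀ x y : Fin p → ℝ, Integrable
      (fun t : ℝ≥0 => Real.exp (-(t : ℝ) * ∑ i, |x i - y i| ^ q)) μ := fun x y => by
    refine Integrable.of_bound (C := 1) (by fun_prop) (.of_forall fun t => ?_)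
    rw [Real.norm_eq_abs, abs_of_pos (Real.exp_pos _), Real.exp_le_one_iff, neg_mul,
      neg_nonpos]
    positivity
  have h := posSemidef_integral μ
    (fun t => .of fun x y : Fin p → ℝ => Real.exp (-(t : ℝ) * ∑ i, |x i - y i| ^ q))
    (fun t => posSemidef_exp_sum t t.2 q p hq) hi
  have key := (RKHS.posSemidef_tfae (K := lqKernel μ q p)).out 0 2
  refine key.2 ⟨?_, fun vv => ?_⟩
  · ext x y
    have h1 : ContinuousLinearMap.adjoint (ContinuousLinearMap.id ℝ ℝ) =
        ContinuousLinearMap.id ℝ ℝ := LinearMap.IsSymmetric.isSelfAdjoint fun _ _ => rfl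
    simp [lqKernel, Matrix.conjTranspose_apply, ContinuousLinearMap.star_eq_adjoint,
      abs_sub_comm, h1]
  · convert! h.2 vv using 1
    simp only [Finsupp.sum, lqKernel, profile, Matrix.of_apply, RCLike.re_to_real]
    refine Finset.sum_congr rfl fun x _ => Finset.sum_congr rfl fun y _ => ?_
    simp [abs_sub_comm (y _), mul_comm, mul_left_comm]

/-- The rescaled vector `β^{1/q} ⊙ x`. -/
def rescale {p : ℕ} (q : ℕ) (β x : Fin p → ℝ) : Fin p → ℝ :=
  fun i => β i ^ (1 / (q : ℝ)) * x i

/-- The penalized least squares functional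
`f ↦ ½ E_Q[(Y - f(β^{1/q} ⊙ X))²] + (lam / 2) ‖f‖²` on an RKHS `H` of functions on `ℝ^p`,
where `(X, Y) ∼ Q`. -/
def krrFunctional {p : ℕ} (H : Type*) [NormedAddCommGroup H] [InnerProductSpace ℝ H]
    [RKHS ℝ H (Fin p → ℝ) ℝ] (q : ℕ) (Q : Measure ((Fin p → ℝ) × ℝ)) (β : Fin p → ℝ)
    (lam : ℝ) (f : H) : ℝ :=
  1 / 2 * ∫ z, (z.2 - f (rescale q β z.1)) ^ 2 ∂Q + lam / 2 * ‖f‖ ^ 2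

/-- The kernel ridge regression objective `F^KRR_lam(β; Q)`. -/
def krrObjective {p : ℕ} (H : Type*) [NormedAddCommGroup H] [InnerProductSpace ℝ H]
    [RKHS ℝ H (Fin p → ℝ) ℝ] (q : ℕ) (Q : Measure ((Fin p → ℝ) × ℝ)) (β : Fin p → ℝ)
    (lam : ℝ) : ℝ :=
  ⨅ f : H, krrFunctional H q Q β lam f

/-- The σ-algebra generated by `X_S`, the coordinates of `X` with index in `S`. -/
@[reducible] def sigmaX {p : ℕ} (S : Set (Fin p)) : MeasurableSpace ((Fin p → ℝ) × ℝ) :=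
  MeasurableSpace.comap (fun z (i : S) => z.1 i) inferInstance

end KernelFeature

end

/-! Write `Z = β^{1/q} ⊙ X`. Since `h` is bounded, composition with `Z` is a bounded operator `T`
from the RKHS to `L²(Q)` (`exists_clm_comp`). Each objective is thus a Tikhonov problem, whose
minimum exists by Lax–Milgram (`exists_forall_tikhonov_le`), and as the penalty vanishes its value
tends to the infimum of the unpenalized risk, attained or not (`tendsto_iInf_penalized`).

That infimum is half the squared distance from `Y` to the closed range of `T`. By Pythagoras it
equals `½ E[Var(Y | Z)]` once `E[Y | Z]` lies in this closure, which is the density statement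
`toLp_comp_mem_closure`. For its proof, let `g` be orthogonal to the range. Testing against kernel
sections shows that the image of `g • Q` under `Z` has zero convolution with `κ(x) = h(‖x‖_q ^ q)`.
The Fourier transform of `κ` is a mixture over `t` of products of one-dimensional transforms (Cauchy
for `q = 1`, Gaussian for `q = 2`), hence positive; so the image measure vanishes and `g` is
orthogonal to every square integrable function of `Z`.

Finally `Z` and `X_{supp β}` generate the same σ-algebra (`sigmaX_eq_comap_rescale`). -/

noncomputable section

namespace KernelFeature

open scoped InnerProductSpace

/-! ### Tikhonov regularization and vanishing penalty -/

/-- The Tikhonov functional on a Hilbert space attains its minimum. -/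
theorem exists_forall_tikhonov_le {E H : Type*} [NormedAddCommGroup E] [InnerProductSpace ℝ E]
    [CompleteSpace E] [NormedAddCommGroup H] [InnerProductSpace ℝ H] [CompleteSpace H]
    (T : H →L[ℝ] E) (y : E) {lam : ℝ} (hlam : 0 < lam) :
    ∃ f₀ : H, ∀ f : H, 1 / 2 * ‖y - T f₀‖ ^ 2 + lam / 2 * ‖f₀‖ ^ 2 ≤
      1 / 2 * ‖y - T f‖ ^ 2 + lam / 2 * ‖f‖ ^ 2 := by
  -- The form of the normal equation `(T* T + lam) f₀ = T* y`, coercive with constant `lam`.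
  let B : H →L[ℝ] H →L[ℝ] ℝ :=
    (innerSL ℝ).comp (T.adjoint.comp T + lam • ContinuousLinearMap.id ℝ H)
  have hB : ∀ f g, B f g = ⟪T f, T g⟫_ℝ + lam * ⟪f, g⟫_ℝ := fun f g => by
    have : B f g = ⟪T.adjoint (T f) + lam • f, g⟫_ℝ := rfl
    rw [this, inner_add_left, real_inner_smul_left, ContinuousLinearMap.adjoint_inner_left]
  have hcoer : IsCoercive B := ⟨lam, hlam, fun u => by
    rw [hB, real_inner_self_eq_norm_sq, real_inner_self_eq_norm_sq]
    nlinarith [sq_nonneg ‖T u‖]⟩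
  obtain ⟨f₀, hf₀⟩ := hcoer.continuousLinearEquivOfBilin.surjective (T.adjoint y)
  have h₀ : ∀ g, ⟪T f₀, T g⟫_ℝ + lam * ⟪f₀, g⟫_ℝ = ⟪y, T g⟫_ℝ := fun g => by
    rw [← hB, ← hcoer.continuousLinearEquivOfBilin_apply, hf₀,
      ContinuousLinearMap.adjoint_inner_left]
  refine ⟨f₀, fun f => ?_⟩
  obtain ⟨g, rfl⟩ : ∃ g, f = f₀ + g := ⟨f - f₀, by abel⟩
  have h1 : y - T (f₀ + g) = (y - T f₀) - T g := by rw [map_add]; abel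
  rw [h1, norm_sub_sq_real (y - T f₀), norm_add_sq_real, inner_sub_left]
  -- The terms linear in `g` cancel by the normal equation `h₀`; what remains is `½ ‖T g‖² + lam / 2
  -- ‖g‖²`.
  nlinarith [h₀ g, sq_nonneg ‖T g‖, sq_nonneg ‖g‖, mul_nonneg hlam.le (sq_nonneg ‖g‖)]

/-- As the penalty vanishes, the optimal penalized risk tends to the optimal risk. -/
theorem tendsto_iInf_penalized {ι : Type*} {R N : ι → ℝ} (hN : ∀ i, 0 ≤ N i) {c : ℝ}
    (hc : IsGLB (Set.range R) c) :
    Tendsto (fun lam : ℝ => ⨅ i, (R i + lam / 2 * N i)) (𝓝[>] 0) (𝓝 c) := by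
  have hne : Nonempty ι := Set.range_nonempty_iff_nonempty.1 hc.nonempty
  have hlow : ∀ lam : ℝ, 0 < lam → ∀ i, c ≤ R i + lam / 2 * N i := fun lam hl i =>
    (hc.1 ⟨i, rfl⟩).trans (le_add_of_nonneg_right (mul_nonneg (by positivity) (hN i)))
  refine tendsto_order.2 ⟨fun a ha => ?_, fun a ha => ?_⟩
  · filter_upwards [self_mem_nhdsWithin] with lam hl
    exact ha.trans_le (le_ciInf (hlow lam hl))
  -- A near-minimizer of `R`, fixed independently of `lam`, has a penalty that tends to zero.
  · obtain ⟨_, ⟨i, rfl⟩, -, hi⟩ := hc.exists_between ha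
    have ht : Tendsto (fun lam : ℝ => R i + lam / 2 * N i) (𝓝[>] 0) (𝓝 (R i)) := by
      have : Continuous fun lam : ℝ => R i + lam / 2 * N i := by fun_prop
      simpa using (this.tendsto 0).mono_left nhdsWithin_le_nhds
    filter_upwards [self_mem_nhdsWithin, ht.eventually_lt_const hi] with lam hl hlt
    exact (ciInf_le ⟨c, by rintro _ ⟨j, rfl⟩; exact hlow lam hl j⟩ i).trans_lt hlt

/-! ### Fourier transform of the kernel -/

theorem integrable_exp_neg_mul_abs_pow {q : ℕ} (hq : q = 1 ∨ q = 2) {t : ℝ} (ht : 0 < t) :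
    Integrable fun s : ℝ => Real.exp (-t * |s| ^ q) := by
  rcases hq with rfl | rfl
  · have h1 : IntegrableOn (fun s : ℝ => Real.exp (-t * |s| ^ 1)) (Set.Ioi 0) := by
      refine (integrableOn_exp_mul_Ioi (a := -t) (by linarith) 0).congr_fun (fun s hs => ?_)
        measurableSet_Ioi
      simp [abs_of_pos (Set.mem_Ioi.1 hs)]
    have h2 : IntegrableOn (fun s : ℝ => Real.exp (-t * |s| ^ 1)) (Set.Iic 0) := by
      refine (integrableOn_exp_mul_Iic ht 0).congr_fun (fun s hs => ?_) measurableSet_Iic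
      simp [abs_of_nonpos (Set.mem_Iic.1 hs)]
    rw [← integrableOn_univ, ← Set.Iic_union_Ioi (a := (0 : ℝ))]
    exact h2.union h1
  · simpa using integrable_exp_neg_mul_sq ht

theorem integrable_mul_cexp {α : Type*} [MeasurableSpace α] {ν : Measure α} {f φ : α → ℝ}
    (hf : Integrable f ν) (hφ : AEStronglyMeasurable φ ν) :
    Integrable (fun x => (f x : ℂ) * Complex.exp (φ x * Complex.I)) ν := by
  refine hf.ofReal.mul_bdd (c := 1) ?_ (.of_forall fun x => ?_)
  · exact Complex.continuous_exp.comp_aestronglyMeasurable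
      ((Complex.continuous_ofReal.comp_aestronglyMeasurable hφ).mul_const _)
  · rw [Complex.norm_exp_ofReal_mul_I]

/-- The Fourier transform of `s ↦ exp (-t |s| ^ q)` is positive. -/
theorem exists_pos_fourier_exp_neg_mul_abs_pow {q : ℕ} (hq : q = 1 ∨ q = 2) {t : ℝ} (ht : 0 < t)
    (a : ℝ) : ∃ r : ℝ, 0 < r ∧
      ∫ s : ℝ, (Real.exp (-t * |s| ^ q) : ℂ) * Complex.exp (((a * s : ℝ) : ℂ) * Complex.I) = r := by
  have hint := integrable_mul_cexp (integrable_exp_neg_mul_abs_pow hq ht)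
    (φ := fun s => a * s) (by fun_prop)
  rcases hq with rfl | rfl
  -- The two half-lines contribute `1 / (t + a i)` and `1 / (t - a i)`.
  · refine ⟨2 * t / (t ^ 2 + a ^ 2), by positivity, ?_⟩
    rw [← integral_add_compl measurableSet_Iic hint (s := Set.Iic (0 : ℝ)), Set.compl_Iic]
    have h1 : ∫ s in Set.Iic (0 : ℝ), (Real.exp (-t * |s| ^ 1) : ℂ) *
        Complex.exp (((a * s : ℝ) : ℂ) * Complex.I) =
        ∫ s in Set.Iic (0 : ℝ), Complex.exp ((t + a * Complex.I) * s) := by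
      refine setIntegral_congr_fun measurableSet_Iic fun s hs => ?_
      simp only [abs_of_nonpos (Set.mem_Iic.1 hs), Complex.ofReal_exp, ← Complex.exp_add]
      congr 1
      push_cast
      ring
    have h2 : ∫ s in Set.Ioi (0 : ℝ), (Real.exp (-t * |s| ^ 1) : ℂ) *
        Complex.exp (((a * s : ℝ) : ℂ) * Complex.I) =
        ∫ s in Set.Ioi (0 : ℝ), Complex.exp ((-t + a * Complex.I) * s) := by
      refine setIntegral_congr_fun measurableSet_Ioi fun s hs => ?_
      simp only [abs_of_pos (Set.mem_Ioi.1 hs), Complex.ofReal_exp, ← Complex.exp_add]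
      congr 1
      push_cast
      ring
    rw [h1, h2, integral_exp_mul_complex_Iic (by simpa using ht),
      integral_exp_mul_complex_Ioi (by simpa using ht)]
    have e1 : (t + a * Complex.I : ℂ) ≠ 0 := fun h => ht.ne' (by simpa using congrArg Complex.re h)
    have e2 : (-t + a * Complex.I : ℂ) ≠ 0 := fun h => ht.ne' (by simpa using congrArg Complex.re h)
    have e3 : (t ^ 2 + a ^ 2 : ℂ) ≠ 0 := by
      have : (t ^ 2 + a ^ 2 : ℝ) ≠ 0 := by positivity
      exact_mod_cast this
    simp only [Complex.ofReal_zero, mul_zero, Complex.exp_zero]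
    push_cast
    field_simp
    linear_combination (-2 * t * a ^ 2 : ℂ) * Complex.I_sq
  · refine ⟨(Real.pi / t) ^ (1 / 2 : ℝ) * Real.exp (-a ^ 2 / (4 * t)), by positivity, ?_⟩
    have h := fourierIntegral_gaussian (b := t) (by simpa using ht) a
    rw [Complex.ofReal_mul, Complex.ofReal_cpow (by positivity)]
    push_cast
    rw [← h]
    refine integral_congr_ae (.of_forall fun s => ?_)
    simp only [← Complex.exp_add, ← Complex.ofReal_pow, sq_abs]
    congr 1
    push_cast
    ring

theorem integrable_exp_neg_mul_sum {q : ℕ} (hq : q = 1 ∨ q = 2) {t : ℝ} (ht : 0 < t) (p : ℕ) :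
    Integrable fun x : Fin p → ℝ => Real.exp (-t * ∑ i, |x i| ^ q) := by
  have := Integrable.fintype_prod (ι := Fin p) (f := fun _ s => Real.exp (-t * |s| ^ q))
    (μ := fun _ => volume) fun _ => integrable_exp_neg_mul_abs_pow hq ht
  simp only [Finset.mul_sum, Real.exp_sum]
  exact this

theorem exists_pos_fourier_exp_neg_mul_sum {q : ℕ} (hq : q = 1 ∨ q = 2) {t : ℝ} (ht : 0 < t)
    {p : ℕ} (a : Fin p → ℝ) : ∃ r : ℝ, 0 < r ∧
      ∫ x : Fin p → ℝ, (Real.exp (-t * ∑ i, |x i| ^ q) : ℂ) *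
        Complex.exp (((∑ i, a i * x i : ℝ) : ℂ) * Complex.I) = r := by
  choose r hr h using fun i => exists_pos_fourier_exp_neg_mul_abs_pow hq ht (a i)
  refine ⟨∏ i, r i, Finset.prod_pos fun i _ => hr i, ?_⟩
  rw [Complex.ofReal_prod, ← Finset.prod_congr rfl fun i _ => h i, ← integral_fintype_prod_volume_eq_prod
    (f := fun i s => (Real.exp (-t * |s| ^ q) : ℂ) *
      Complex.exp (((a i * s : ℝ) : ℂ) * Complex.I))]
  refine integral_congr_ae (.of_forall fun x => ?_)
  simp only [Finset.prod_mul_distrib, ← Complex.exp_sum, Finset.mul_sum, Real.exp_sum,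
    Complex.ofReal_prod, Complex.ofReal_sum, Finset.sum_mul]

theorem measurable_profile (μ : Measure ℝ≥0) [IsFiniteMeasure μ] : Measurable (profile μ) := by
  have : StronglyMeasurable fun x : ℝ × ℝ≥0 => Real.exp (-(x.2 : ℝ) * x.1) :=
    Measurable.stronglyMeasurable (by fun_prop)
  exact this.integral_prod_right.measurable

/-- As `μ`-almost every `t` is at least `m = inf supp μ > 0`, the integrable function `exp (-m ‖x‖_q
^ q)` dominates. This licenses Fubini between `x` and `t`. -/
theorem integrable_profile_prod {μ : Measure ℝ≥0} [IsFiniteMeasure μ] (hμ : SupportRegular μ)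
    {q : ℕ} (hq : q = 1 ∨ q = 2) (p : ℕ) :
    Integrable (fun x : (Fin p → ℝ) × ℝ≥0 => Real.exp (-(x.2 : ℝ) * ∑ i, |x.1 i| ^ q))
      (volume.prod μ) := by
  have hm : (0 : ℝ) < (sInf μ.support : ℝ≥0) := by exact_mod_cast hμ.inf_pos
  refine ((integrable_exp_neg_mul_sum hq hm p).comp_fst μ).mono' (by fun_prop) ?_
  have h : ∀ᵐ x ∂((volume : Measure (Fin p → ℝ)).prod μ), x.2 ∈ μ.support :=
    Measure.quasiMeasurePreserving_snd.ae Measure.support_mem_ae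
  filter_upwards [h] with x hx
  rw [Real.norm_eq_abs, abs_of_pos (Real.exp_pos _), Real.exp_le_exp]
  have h1 : ((sInf μ.support : ℝ≥0) : ℝ) ≤ x.2 := by exact_mod_cast csInf_le' hx
  have h2 : 0 ≤ ∑ i, |x.1 i| ^ q := by positivity
  nlinarith

theorem integrable_profile_sum {μ : Measure ℝ≥0} [IsFiniteMeasure μ] (hμ : SupportRegular μ)
    {q : ℕ} (hq : q = 1 ∨ q = 2) (p : ℕ) :
    Integrable fun x : Fin p → ℝ => profile μ (∑ i, |x i| ^ q) :=
  (integrable_profile_prod hμ hq p).integral_prod_left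

/-- The Fourier transform of `x ↦ h(‖x‖_q ^ q)` vanishes nowhere. -/
theorem fourier_profile_ne_zero {μ : Measure ℝ≥0} [IsFiniteMeasure μ] (hμ : SupportRegular μ)
    {q : ℕ} (hq : q = 1 ∨ q = 2) {p : ℕ} (a : Fin p → ℝ) :
    ∫ x : Fin p → ℝ, (profile μ (∑ i, |x i| ^ q) : ℂ) *
        Complex.exp (((∑ i, a i * x i : ℝ) : ℂ) * Complex.I) ≠ 0 := by
  have hI := integrable_mul_cexp (integrable_profile_prod hμ hq p)
    (φ := fun x => ∑ i, a i * x.1 i) (by fun_prop)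
  have h1 : ∫ x : Fin p → ℝ, (profile μ (∑ i, |x i| ^ q) : ℂ) *
        Complex.exp (((∑ i, a i * x i : ℝ) : ℂ) * Complex.I) =
      ∫ t : ℝ≥0, (∫ x : Fin p → ℝ, (Real.exp (-(t : ℝ) * ∑ i, |x i| ^ q) : ℂ) *
        Complex.exp (((∑ i, a i * x i : ℝ) : ℂ) * Complex.I)) ∂μ := by
    rw [integral_integral_swap (f := fun (t : ℝ≥0) (x : Fin p → ℝ) =>
      (Real.exp (-(t : ℝ) * ∑ i, |x i| ^ q) : ℂ) *
        Complex.exp (((∑ i, a i * x i : ℝ) : ℂ) * Complex.I)) hI.swap]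
    refine integral_congr_ae (.of_forall fun x => ?_)
    simp only [profile]
    rw [integral_mul_const, integral_complex_ofReal]
  set F : ℝ≥0 → ℂ := fun t => ∫ x : Fin p → ℝ, (Real.exp (-(t : ℝ) * ∑ i, |x i| ^ q) : ℂ) *
        Complex.exp (((∑ i, a i * x i : ℝ) : ℂ) * Complex.I)
  have hFi : Integrable F μ := hI.integral_prod_right
  have hpos : ∀ t : ℝ≥0, 0 < t → 0 < (F t).re := fun t ht => by
    obtain ⟨r, hr, h⟩ := exists_pos_fourier_exp_neg_mul_sum hq (t := t) (by exact_mod_cast ht) a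
    simpa only [F, h, Complex.ofReal_re] using hr
  have hae : ∀ᵐ t ∂μ, 0 < t := by
    filter_upwards [Measure.support_mem_ae (μ := μ)] with t ht
    exact hμ.inf_pos.trans_le (csInf_le' ht)
  -- Positivity for almost every `t`, together with positive mass, excludes cancellation in the
  -- mixture.
  have h2 : 0 < ∫ t, (F t).re ∂μ := by
    rw [integral_pos_iff_support_of_nonneg_ae (hae.mono fun t ht => (hpos t ht).le) hFi.re]
    exact hμ.pos_mass.trans_le (measure_mono fun t ht => (hpos t ht).ne')
  intro h
  rw [h1] at h
  have h3 := integral_re hFi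
  simp only [RCLike.re_to_complex] at h3
  exact h2.ne' (h3.trans (congrArg Complex.re h))

/-! ### Injectivity of convolution and uniqueness of characteristic functions -/

/-- If the convolution of a measure with an integrable function of nowhere vanishing Fourier
transform is zero, then so is the characteristic function of the measure. -/
theorem integral_mul_cexp_eq_zero {Ω : Type*} [MeasurableSpace Ω] {Q : Measure Ω} [SFinite Q]
    {p : ℕ} {Z : Ω → Fin p → ℝ} (hZ : Measurable Z) {g : Ω → ℝ} (hg : Integrable g Q)
    {κ : (Fin p → ℝ) → ℝ} (hκm : Measurable κ) (hκ : Integrable κ)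
    (hF : ∀ a : Fin p → ℝ, ∫ x, (κ x : ℂ) *
      Complex.exp (((∑ i, a i * x i : ℝ) : ℂ) * Complex.I) ≠ 0)
    (h0 : ∀ x, ∫ ω, g ω * κ (x - Z ω) ∂Q = 0) (a : Fin p → ℝ) :
    ∫ ω, (g ω : ℂ) * Complex.exp (((∑ i, a i * Z ω i : ℝ) : ℂ) * Complex.I) ∂Q = 0 := by
  have hG : Integrable (fun y : Ω × (Fin p → ℝ) => g y.1 * κ (y.2 - Z y.1)) (Q.prod volume) := by
    have hm : AEStronglyMeasurable (fun y : Ω × (Fin p → ℝ) => g y.1 * κ (y.2 - Z y.1))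
        (Q.prod volume) := by
      refine hg.1.comp_fst.mul (Measurable.aestronglyMeasurable ?_)
      fun_prop
    refine (integrable_prod_iff hm).2 ⟨.of_forall fun ω => ?_, ?_⟩
    · exact (hκ.comp_sub_right (Z ω)).const_mul (g ω)
    · simp only [norm_mul, integral_const_mul]
      simp_rw [fun ω => integral_sub_right_eq_self (μ := (volume : Measure (Fin p → ℝ)))
        (fun x => ‖κ x‖) (Z ω)]
      exact hg.norm.mul_const _
  have hG' := integrable_mul_cexp hG (φ := fun y => ∑ i, a i * y.2 i) (by fun_prop)
  -- Both iterated integrals are computed: integrating in `ω` first gives zero by `h0`; integrating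
  -- in `x` first gives, after translation by `Z ω`, the characteristic function times the transform
  -- of `κ`.
  have h1 := integral_integral_swap (f := fun ω (x : Fin p → ℝ) => ((g ω * κ (x - Z ω) : ℝ) : ℂ) *
      Complex.exp (((∑ i, a i * x i : ℝ) : ℂ) * Complex.I)) hG'
  have h2 : ∀ x : Fin p → ℝ, ∫ ω, ((g ω * κ (x - Z ω) : ℝ) : ℂ) *
      Complex.exp (((∑ i, a i * x i : ℝ) : ℂ) * Complex.I) ∂Q = 0 := fun x => by
    rw [integral_mul_const, integral_complex_ofReal, h0, Complex.ofReal_zero, zero_mul]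
  have h3 : ∀ ω, ∫ x : Fin p → ℝ, ((g ω * κ (x - Z ω) : ℝ) : ℂ) *
      Complex.exp (((∑ i, a i * x i : ℝ) : ℂ) * Complex.I) =
      ((g ω : ℂ) * Complex.exp (((∑ i, a i * Z ω i : ℝ) : ℂ) * Complex.I)) *
      ∫ x, (κ x : ℂ) * Complex.exp (((∑ i, a i * x i : ℝ) : ℂ) * Complex.I) := fun ω => by
    rw [← integral_const_mul, ← integral_sub_right_eq_self (fun x : Fin p → ℝ =>
      ((g ω : ℂ) * Complex.exp (((∑ i, a i * Z ω i : ℝ) : ℂ) * Complex.I)) *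
      ((κ x : ℂ) * Complex.exp (((∑ i, a i * x i : ℝ) : ℂ) * Complex.I))) (Z ω)]
    refine integral_congr_ae (.of_forall fun x => ?_)
    have he : (∑ i, a i * x i : ℝ) = ∑ i, a i * Z ω i + ∑ i, a i * (x - Z ω) i := by
      rw [← Finset.sum_add_distrib]
      exact Finset.sum_congr rfl fun i _ => by simp; ring
    simp only [he, Complex.ofReal_add, add_mul, Complex.exp_add, Complex.ofReal_mul]
    ring
  simp only [h2, h3, integral_zero, integral_mul_const] at h1
  exact (mul_eq_zero.1 h1).resolve_right (hF a)

/-- If the signed measure `g • Q` has an image under `Z` with zero characteristic function, then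
`g` is orthogonal to every function of `Z`. -/
theorem integral_comp_mul_eq_zero {Ω : Type*} [MeasurableSpace Ω] {Q : Measure Ω}
    {p : ℕ} {Z : Ω → Fin p → ℝ} (hZ : Measurable Z) {g : Ω → ℝ} (hgm : Measurable g)
    (hg : Integrable g Q)
    (h0 : ∀ a : Fin p → ℝ,
      ∫ ω, (g ω : ℂ) * Complex.exp (((∑ i, a i * Z ω i : ℝ) : ℂ) * Complex.I) ∂Q = 0)
    {w : (Fin p → ℝ) → ℝ} (hw : Measurable w) (hwg : Integrable (fun ω => w (Z ω) * g ω) Q) :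
    ∫ ω, w (Z ω) * g ω ∂Q = 0 := by
  -- `ENNReal.ofReal` truncates at zero, so `g` and `-g` as densities give the positive and negative
  -- parts of `g • Q`. Uniqueness of characteristic functions is applied to these two finite
  -- measures.
  have hfin : ∀ {f : Ω → ℝ}, Integrable f Q →
      IsFiniteMeasure ((Q.withDensity fun ω => ENNReal.ofReal (f ω)).map Z) := fun hf =>
    have := isFiniteMeasure_withDensity_ofReal hf.2
    inferInstance
  have hgm' : Measurable fun ω => -g ω := hgm.neg
  have := hfin hg
  have : IsFiniteMeasure ((Q.withDensity fun ω => ENNReal.ofReal (-g ω)).map Z) := hfin hg.neg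
  have hint : ∀ {f : Ω → ℝ}, Measurable f → ∀ {E : Type} [NormedAddCommGroup E]
      [NormedSpace ℝ E] {φ : (Fin p → ℝ) → E}, StronglyMeasurable φ →
      ∫ x, φ x ∂((Q.withDensity fun ω => ENNReal.ofReal (f ω)).map Z) =
        ∫ ω, max (f ω) 0 • φ (Z ω) ∂Q := fun {f} hf E _ _ φ hφ => by
    rw [integral_map hZ.aemeasurable hφ.aestronglyMeasurable,
      integral_withDensity_eq_integral_toReal_smul hf.ennreal_ofReal (.of_forall fun _ => ENNReal.ofReal_lt_top)]
    simp only [ENNReal.toReal_ofReal']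
  have hsub : ∀ x : ℝ, max x 0 - max (-x) 0 = x := fun x => by
    rcases le_total x 0 with h | h <;> simp [h]
  have heq : (Q.withDensity fun ω => ENNReal.ofReal (g ω)).map Z =
      (Q.withDensity fun ω => ENNReal.ofReal (-g ω)).map Z := by
    refine Measure.ext_of_charFunDual (funext fun L => ?_)
    -- A continuous linear functional is given by its coordinates, so `h0` covers every `L`.
    have hL : ∀ x, L x = ∑ i, L (Pi.single i 1) * x i := fun x => by
      conv_lhs => rw [← Finset.univ_sum_single x]
      rw [map_sum]
      refine Finset.sum_congr rfl fun i _ => ?_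
      rw [mul_comm, ← smul_eq_mul, ← map_smul, ← Pi.single_smul, smul_eq_mul, mul_one]
    have hs : StronglyMeasurable fun x => Complex.exp (L x * Complex.I) :=
      Continuous.stronglyMeasurable (by fun_prop)
    rw [charFunDual_apply, charFunDual_apply, hint hgm hs, hint hgm' hs, ← sub_eq_zero,
      ← integral_sub]
    · refine (integral_congr_ae (.of_forall fun ω => ?_)).trans (h0 fun i => L (Pi.single i 1))
      rw [← sub_smul, hsub, Complex.real_smul, hL]
    · simp only [Complex.real_smul]
      exact integrable_mul_cexp hg.pos_part (by fun_prop)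
    · simp only [Complex.real_smul]
      exact integrable_mul_cexp hg.neg_part (by fun_prop)
  have hi : ∀ {f : Ω → ℝ}, Measurable f → (∀ ω, |f ω| = |g ω|) →
      Integrable (fun ω => max (f ω) 0 • w (Z ω)) Q := fun hf hfg => by
    refine hwg.mono (by fun_prop) (.of_forall fun ω => ?_)
    rw [norm_smul, norm_mul, mul_comm]
    gcongr
    rw [Real.norm_eq_abs, Real.norm_eq_abs, ← hfg, abs_of_nonneg (le_max_right _ _)]
    exact max_le (le_abs_self _) (abs_nonneg _)
  have h1 := hint hgm hw.stronglyMeasurable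
  rw [heq, hint hgm' hw.stronglyMeasurable, eq_comm, ← sub_eq_zero,
    ← integral_sub (hi hgm fun _ => rfl) (hi hgm' fun _ => abs_neg _)] at h1
  refine (integral_congr_ae (.of_forall fun ω => ?_)).trans h1
  rw [← sub_smul, hsub, smul_eq_mul, mul_comm]

/-! ### Least squares and conditional expectation -/

/-- If the projection `e` of `y` is a limit of values of `T`, then the least squares risk has
infimum `½ ‖y - e‖²`. -/
theorem isGLB_range_of_mem_closure {E H : Type*} [NormedAddCommGroup E] [InnerProductSpace ℝ E]
    (T : H → E) {y e : E} (he : e ∈ closure (Set.range T))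
    (horth : ∀ f, ⟪y - e, e - T f⟫_ℝ = 0) :
    IsGLB (Set.range fun f => 1 / 2 * ‖y - T f‖ ^ 2) (1 / 2 * ‖y - e‖ ^ 2) := by
  refine ⟨?_, fun b hb => ?_⟩
  · rintro _ ⟨f, rfl⟩
    have h : y - T f = (y - e) + (e - T f) := by abel
    dsimp only
    rw [h, norm_add_sq_real, horth]
    nlinarith [sq_nonneg ‖e - T f‖]
  · have hcl : IsClosed {v : E | b ≤ 1 / 2 * ‖y - v‖ ^ 2} :=
      isClosed_le continuous_const (by fun_prop)
    exact closure_minimal (s := Set.range T) (Set.range_subset_iff.2 fun f => hb ⟨f, rfl⟩) hcl he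

/-- The residual has zero conditional expectation, and the `m`-measurable factor `φ` can be pulled
out before integrating. -/
theorem integral_sub_condExp_mul_eq_zero {Ω : Type*} {m m₀ : MeasurableSpace Ω} (hm : m ≤ m₀)
    {Q : Measure Ω} [IsFiniteMeasure Q] {Y φ : Ω → ℝ} (hY : MemLp Y 2 Q)
    (hφm : StronglyMeasurable[m] φ) (hφ : MemLp φ 2 Q) :
    ∫ ω, (Y ω - (Q[Y | m]) ω) * φ ω ∂Q = 0 := by
  have hE : MemLp (Q[Y | m]) 2 Q := hY.condExp one_le_two
  have hYi := hY.integrable one_le_two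
  have hz : Q[Y - Q[Y | m] | m] =ᵐ[Q] 0 := by
    refine (condExp_sub hYi integrable_condExp m).trans ?_
    rw [condExp_of_stronglyMeasurable hm stronglyMeasurable_condExp integrable_condExp, sub_self]
  have hi : Integrable ((Y - Q[Y | m]) * φ) Q := (hY.sub hE).integrable_mul hφ
  have h := integral_condExp (f := (Y - Q[Y | m]) * φ) (μ := Q) hm
  rw [← show ∫ ω, ((Y - Q[Y | m]) * φ) ω ∂Q = ∫ ω, (Y ω - (Q[Y | m]) ω) * φ ω ∂Q from rfl, ← h]
  refine integral_eq_zero_of_ae ?_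
  filter_upwards [condExp_mul_of_stronglyMeasurable_right hφm hi (hYi.sub integrable_condExp), hz]
    with ω h1 h2
  simp [h1, h2]

/-! ### Regularity of the functions in the RKHS -/

theorem kerFun_apply_eq_profile {μ : Measure ℝ≥0} {q p : ℕ} {H : Type*} [NormedAddCommGroup H]
    [InnerProductSpace ℝ H] [CompleteSpace H] [RKHS ℝ H (Fin p → ℝ) ℝ]
    (hH : RKHS.kernel H = lqKernel μ q p) (x x' : Fin p → ℝ) (v : ℝ) :
    RKHS.kerFun H x v x' = profile μ (∑ i, |x' i - x i| ^ q) * v := by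
  rw [RKHS.kerFun_apply, hH]
  simp [lqKernel]

/-- Kernel sections are measurable and span a dense subspace; norm convergence in an RKHS implies
pointwise convergence, which preserves measurability. -/
theorem measurable_coe_rkhs {μ : Measure ℝ≥0} [IsFiniteMeasure μ] {q p : ℕ} {H : Type*}
    [NormedAddCommGroup H] [InnerProductSpace ℝ H] [CompleteSpace H] [RKHS ℝ H (Fin p → ℝ) ℝ]
    (hH : RKHS.kernel H = lqKernel μ q p) (f : H) : Measurable f := by
  let N : Submodule ℝ H :=
    { carrier := {f | Measurable f}
      add_mem' := fun {f g} (hf : Measurable f) (hg : Measurable g) => by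
        simpa only [Set.mem_ofPred_eq, RKHS.coe_add] using hf.add hg
      zero_mem' := by simpa only [Set.mem_ofPred_eq, RKHS.coe_zero] using measurable_zero
      smul_mem' := fun c f (hf : Measurable f) => by
        simpa only [Set.mem_ofPred_eq, RKHS.coe_smul] using hf.const_smul c }
  have hN : IsClosed (N : Set H) := by
    refine IsSeqClosed.isClosed fun u f hu hf => ?_
    refine measurable_of_tendsto_metrizable (f := fun n => ⇑(u n)) hu (tendsto_pi_nhds.2 fun x => ?_)
    exact ((RKHS.continuous_eval x).tendsto f).comp hf
  have hle : Submodule.topologicalClosure (Submodule.span ℝ {RKHS.kerFun H x v | (x) (v)}) ≤ N := by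
    refine Submodule.topologicalClosure_minimal _ (Submodule.span_le.2 ?_) hN
    rintro _ ⟨x, v, rfl⟩
    change Measurable fun x' => RKHS.kerFun H x v x'
    simp only [kerFun_apply_eq_profile hH]
    exact ((measurable_profile μ).comp (by fun_prop)).mul_const _
  rw [RKHS.kerFun_dense] at hle
  exact hle trivial

theorem norm_coe_rkhs_le {μ : Measure ℝ≥0} {q p : ℕ} (hq : q ≠ 0) {H : Type*}
    [NormedAddCommGroup H] [InnerProductSpace ℝ H] [CompleteSpace H] [RKHS ℝ H (Fin p → ℝ) ℝ]
    (hH : RKHS.kernel H = lqKernel μ q p) (f : H) (x : Fin p → ℝ) :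
    ‖f x‖ ≤ √|profile μ 0| * ‖f‖ := by
  refine (RKHS.norm_apply_le f x).trans_eq ?_
  rw [hH, mul_comm]
  simp [lqKernel, hq, norm_smul]

theorem memLp_coe_rkhs_comp {μ : Measure ℝ≥0} [IsFiniteMeasure μ] {q p : ℕ} (hq : q ≠ 0)
    {H : Type*} [NormedAddCommGroup H] [InnerProductSpace ℝ H] [CompleteSpace H]
    [RKHS ℝ H (Fin p → ℝ) ℝ] (hH : RKHS.kernel H = lqKernel μ q p) {Ω : Type*}
    [MeasurableSpace Ω] (Q : Measure Ω) [IsFiniteMeasure Q] {Z : Ω → Fin p → ℝ}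
    (hZ : Measurable Z) (f : H) : MemLp (fun ω => f (Z ω)) 2 Q :=
  .of_bound ((measurable_coe_rkhs hH f).comp hZ).aestronglyMeasurable _
    (.of_forall fun ω => norm_coe_rkhs_le hq hH f (Z ω))

/-- Composition with `Z`, as a bounded operator from the RKHS to `L²(Q)`. -/
theorem exists_clm_comp {μ : Measure ℝ≥0} [IsFiniteMeasure μ] {q p : ℕ} (hq : q ≠ 0)
    {H : Type*} [NormedAddCommGroup H] [InnerProductSpace ℝ H] [CompleteSpace H]
    [RKHS ℝ H (Fin p → ℝ) ℝ] (hH : RKHS.kernel H = lqKernel μ q p) {Ω : Type*}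
    [MeasurableSpace Ω] (Q : Measure Ω) [IsFiniteMeasure Q] {Z : Ω → Fin p → ℝ}
    (hZ : Measurable Z) :
    ∃ T : H →L[ℝ] Lp ℝ 2 Q, ∀ f, T f = (memLp_coe_rkhs_comp hq hH Q hZ f).toLp := by
  let T : H →ₗ[ℝ] Lp ℝ 2 Q :=
    { toFun := fun f => (memLp_coe_rkhs_comp hq hH Q hZ f).toLp
      map_add' := fun f g => by
        rw [← MemLp.toLp_add]
        refine MemLp.toLp_congr _ _ (.of_forall fun ω => ?_)
        simp
      map_smul' := fun c f => by
        rw [RingHom.id_apply, ← MemLp.toLp_const_smul]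
        refine MemLp.toLp_congr _ _ (.of_forall fun ω => ?_)
        simp }
  refine ⟨T.mkContinuous (measureUnivNNReal Q ^ (2 : ENNReal).toReal⁻¹ * √|profile μ 0|)
    fun f => ?_, fun f => rfl⟩
  rw [mul_assoc]
  refine Lp.norm_le_of_ae_bound (by positivity) ?_
  filter_upwards [(memLp_coe_rkhs_comp hq hH Q hZ f).coeFn_toLp] with ω hω
  exact (congrArg norm hω).trans_le (norm_coe_rkhs_le hq hH f (Z ω))

/-! ### Density in `L²` of the functions of `Z` -/

/-- Every square integrable function of `Z` is an `L²`-limit of functions `f ∘ Z` with `f` in the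
RKHS. -/
theorem toLp_comp_mem_closure {μ : Measure ℝ≥0} [IsFiniteMeasure μ] (hμ : SupportRegular μ)
    {q p : ℕ} (hq : q = 1 ∨ q = 2)
    {H : Type*} [NormedAddCommGroup H] [InnerProductSpace ℝ H] [CompleteSpace H]
    [RKHS ℝ H (Fin p → ℝ) ℝ] (hH : RKHS.kernel H = lqKernel μ q p) {Ω : Type*}
    [MeasurableSpace Ω] {Q : Measure Ω} [IsFiniteMeasure Q] {Z : Ω → Fin p → ℝ}
    (hZ : Measurable Z) {w : (Fin p → ℝ) → ℝ} (hw : Measurable w)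
    (hwL : MemLp (fun ω => w (Z ω)) 2 Q) (T : H →L[ℝ] Lp ℝ 2 Q)
    (hT : ∀ f, T f =ᵐ[Q] fun ω => f (Z ω)) : hwL.toLp ∈ closure (Set.range T) := by
  have hcl : closure (Set.range T) = ((LinearMap.range (T : H →ₗ[ℝ] Lp ℝ 2 Q)).topologicalClosure :
      Set (Lp ℝ 2 Q)) := by
    rw [Submodule.topologicalClosure_coe]
    rfl
  -- The closure is the double orthogonal complement, so it suffices to test against each `g`
  -- orthogonal to the range.
  rw [hcl, ← Submodule.orthogonal_orthogonal_eq_closure, SetLike.mem_coe, Submodule.mem_orthogonal]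
  intro g hg
  have hgm : Measurable g := (Lp.stronglyMeasurable g).measurable
  have hgL : MemLp g 2 Q := Lp.memLp g
  have h0 : ∀ x, ∫ ω, g ω * profile μ (∑ i, |(x - Z ω) i| ^ q) ∂Q = 0 := fun x => by
    have h := (Submodule.mem_orthogonal _ _).1 hg (T (RKHS.kerFun H x 1)) ⟨_, rfl⟩
    rw [L2.inner_def] at h
    rw [← h]
    refine integral_congr_ae ?_
    filter_upwards [hT (RKHS.kerFun H x 1)] with ω hω
    rw [hω, kerFun_apply_eq_profile hH]
    simp [abs_sub_comm (x _)]
  have hchar := integral_mul_cexp_eq_zero hZ (hgL.integrable one_le_two)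
    (κ := fun x => profile μ (∑ i, |x i| ^ q)) ((measurable_profile μ).comp (by fun_prop))
    (integrable_profile_sum hμ hq p) (fourier_profile_ne_zero hμ hq) h0
  have h := integral_comp_mul_eq_zero hZ hgm (hgL.integrable one_le_two) hchar hw
    (hwL.integrable_mul hgL)
  rw [L2.inner_def, ← h]
  refine integral_congr_ae ?_
  filter_upwards [hwL.coeFn_toLp] with ω hω
  simp [hω]

/-! ### The σ-algebra of the active coordinates and the limiting risk -/

theorem measurable_rescale {p : ℕ} (q : ℕ) (β : Fin p → ℝ) : Measurable (rescale q β) := by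
  unfold rescale
  fun_prop

/-- Each vector is a measurable function of the other: on the support the scaling factor is nonzero
and can be inverted, and off it the rescaled coordinate is the constant `0 ^ (1 / q) = 0`. -/
theorem sigmaX_eq_comap_rescale {p q : ℕ} (hq : q ≠ 0) {β : Fin p → ℝ} (hβ : ∀ i, 0 ≤ β i) :
    sigmaX (Function.support β) =
      MeasurableSpace.comap (fun z : (Fin p → ℝ) × ℝ => rescale q β z.1) inferInstance := by
  classical
  refine le_antisymm ?_ ?_
  · rintro _ ⟨s, hs, rfl⟩
    refine ⟨(fun (v : Fin p → ℝ) (i : Function.support β) =>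
      (β i ^ (1 / (q : ℝ)))⁻¹ * v i) ⁻¹' s, ?_, ?_⟩
    · exact hs.preimage (by fun_prop)
    · ext z
      simp only [Set.mem_preimage]
      congr! 2 with i
      have : β i ^ (1 / (q : ℝ)) ≠ 0 :=
        (Real.rpow_pos_of_pos ((hβ i).lt_of_ne' i.2) _).ne'
      exact inv_mul_cancel_left₀ this (z.1 i)
  · rintro _ ⟨s, hs, rfl⟩
    refine ⟨(fun (v : Function.support β → ℝ) (i : Fin p) =>
      if h : i ∈ Function.support β then β i ^ (1 / (q : ℝ)) * v ⟨i, h⟩ else 0) ⁻¹' s, ?_, ?_⟩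
    · refine hs.preimage (measurable_pi_lambda _ fun i => ?_)
      split_ifs <;> fun_prop
    · ext z
      simp only [Set.mem_preimage]
      congr! 2 with i
      by_cases h : β i = 0
      · simp [rescale, h, hq, Real.zero_rpow]
      · simp [rescale, h]

theorem norm_toLp_sub_toLp_sq {Ω : Type*} [MeasurableSpace Ω] {Q : Measure Ω} {f g : Ω → ℝ}
    (hf : MemLp f 2 Q) (hg : MemLp g 2 Q) :
    ‖hf.toLp - hg.toLp‖ ^ 2 = ∫ ω, (f ω - g ω) ^ 2 ∂Q := by
  rw [← MemLp.toLp_sub, ← real_inner_self_eq_norm_sq, L2.inner_def]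
  refine integral_congr_ae ?_
  filter_upwards [(hf.sub hg).coeFn_toLp] with ω hω
  simp [hω, sq]

/-- The least squares risk over the RKHS composed with `Z` has infimum half the expected
conditional variance given `Z`. -/
theorem isGLB_risk_condVar {μ : Measure ℝ≥0} [IsFiniteMeasure μ] (hμ : SupportRegular μ)
    {q p : ℕ} (hq : q = 1 ∨ q = 2)
    {H : Type*} [NormedAddCommGroup H] [InnerProductSpace ℝ H] [CompleteSpace H]
    [RKHS ℝ H (Fin p → ℝ) ℝ] (hH : RKHS.kernel H = lqKernel μ q p) {Ω : Type*}
    {m m₀ : MeasurableSpace Ω} {Q : Measure Ω} [IsFiniteMeasure Q] {Z : Ω → Fin p → ℝ}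
    (hZ : Measurable Z) (hm : m = MeasurableSpace.comap Z inferInstance) {Y : Ω → ℝ}
    (hY : MemLp Y 2 Q) :
    IsGLB (Set.range fun f : H => 1 / 2 * ∫ ω, (Y ω - f (Z ω)) ^ 2 ∂Q)
      (1 / 2 * ∫ ω, condVar m Y Q ω ∂Q) := by
  have hq0 : q ≠ 0 := by omega
  obtain ⟨T, hT⟩ := exists_clm_comp hq0 hH Q hZ
  have hmle : m ≤ m₀ := hm ▸ hZ.comap_le
  have hE : MemLp (Q[Y | m]) 2 Q := hY.condExp one_le_two
  have hR : ∀ f : H, ∫ ω, (Y ω - f (Z ω)) ^ 2 ∂Q = ‖hY.toLp - T f‖ ^ 2 := fun f => by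
    rw [hT, norm_toLp_sub_toLp_sq]
  have hc : ∫ ω, condVar m Y Q ω ∂Q = ‖hY.toLp - hE.toLp‖ ^ 2 := by
    rw [norm_toLp_sub_toLp_sq]
    exact integral_condExp hmle
  have hmem : hE.toLp ∈ closure (Set.range T) := by
    have hs : Measurable[MeasurableSpace.comap Z inferInstance] (Q[Y | m]) :=
      hm ▸ stronglyMeasurable_condExp.measurable
    -- Doob–Dynkin: the conditional expectation is a measurable function `w` of `Z`, as the density
    -- result requires.
    obtain ⟨w, hw, hwe⟩ := hs.exists_eq_measurable_comp
    have hwL : MemLp (fun ω => w (Z ω)) 2 Q := hE.ae_eq (.of_forall fun ω => congrFun hwe ω)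
    have h := toLp_comp_mem_closure hμ hq hH hZ hw hwL T fun f => by
      rw [hT]
      exact MemLp.coeFn_toLp _
    convert h using 1
    exact MemLp.toLp_congr _ _ (.of_forall fun ω => congrFun hwe ω)
  simp only [hR, hc]
  refine isGLB_range_of_mem_closure T hmem fun f => ?_
  have hfL := memLp_coe_rkhs_comp hq0 hH Q hZ f
  have hfm : StronglyMeasurable[m] fun ω => f (Z ω) := by
    rw [hm]
    exact ((measurable_coe_rkhs hH f).comp (comap_measurable Z)).stronglyMeasurable
  rw [hT, ← MemLp.toLp_sub, ← MemLp.toLp_sub, L2.inner_def,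
    ← integral_sub_condExp_mul_eq_zero hmle hY (stronglyMeasurable_condExp.sub hfm)
      (hE.sub hfL)]
  refine integral_congr_ae ?_
  filter_upwards [(hY.sub hE).coeFn_toLp, (hE.sub hfL).coeFn_toLp] with ω h1 h2
  rw [h1, h2]
  simp [mul_comm]

end KernelFeature

end

theorem mainTheorem8 {p : ℕ} (q : ℕ) (hq : q = 1 ∨ q = 2)
    (μ : Measure ℝ≥0) [IsFiniteMeasure μ] (hμ : KernelFeature.SupportRegular μ)
    (H : Type*) [NormedAddCommGroup H] [InnerProductSpace ℝ H] [CompleteSpace H]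
    [RKHS ℝ H (Fin p → ℝ) ℝ] (hH : RKHS.kernel H = KernelFeature.lqKernel μ q p)
    (Q : Measure ((Fin p → ℝ) × ℝ)) [IsProbabilityMeasure Q]
    (hY : MemLp (fun z : (Fin p → ℝ) × ℝ => z.2) 2 Q)
    (β : Fin p → ℝ) (hβ : ∀ i, 0 ≤ β i) :
    (∀ lam : ℝ, 0 < lam →
      IsLeast (Set.range (KernelFeature.krrFunctional H q Q β lam))
        (KernelFeature.krrObjective H q Q β lam)) ∧
    Tendsto (fun lam : ℝ => KernelFeature.krrObjective H q Q β lam) (𝓝[>] 0)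
      (𝓝 (1 / 2 * ∫ z, condVar (KernelFeature.sigmaX (Function.support β))
        (fun z : (Fin p → ℝ) × ℝ => z.2) Q z ∂Q)) := by
  have hq0 : q ≠ 0 := by omega
  have hZ : Measurable fun z : (Fin p → ℝ) × ℝ => KernelFeature.rescale q β z.1 :=
    (KernelFeature.measurable_rescale q β).comp measurable_fst
  constructor
  · intro lam hlam
    obtain ⟨T, hT⟩ := KernelFeature.exists_clm_comp hq0 hH Q hZ
    obtain ⟨f₀, hf₀⟩ := KernelFeature.exists_forall_tikhonov_le T hY.toLp hlam
    have hmin : ∀ f, KernelFeature.krrFunctional H q Q β lam f₀ ≤ KernelFeature.krrFunctional H q Q β lam f := fun f => by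
      simpa only [KernelFeature.krrFunctional, hT, KernelFeature.norm_toLp_sub_toLp_sq] using hf₀ f
    have heq : KernelFeature.krrObjective H q Q β lam = KernelFeature.krrFunctional H q Q β lam f₀ :=
      le_antisymm (ciInf_le ⟨_, Set.forall_mem_range.2 hmin⟩ f₀) (le_ciInf hmin)
    rw [heq]
    exact ⟨⟨f₀, rfl⟩, Set.forall_mem_range.2 hmin⟩
  · exact KernelFeature.tendsto_iInf_penalized (fun f => sq_nonneg ‖f‖)
      (KernelFeature.isGLB_risk_condVar hμ hq hH hZ (KernelFeature.sigmaX_eq_comap_rescale hq0 hβ) hY)
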